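/- Let $\mathfrak A=(A,+,-,;,{}^{\smile},1')$ be a relation algebra (Tarski's axioms), with Boolean zero $0$ and unit $1$. A function is an element $f$ with $f^{\smile};f\le 1'$. An atom $x\le 1'$ is measurable if $x;1;x$ is the sum (supremum) of a set of functions, and $\mathfrak A$ is measurable if $1'$ is the sum of a set of measurable atoms. Let $I$ be the set of measurable atoms. For $x\in I$ let $G_x$ be the group, under $;$ and ${}^{\smile}$ and with identity element $x$, of all non-zero functions below $x;1;x$ (these groups are pairwise disjoint), and let $\mathcal E$ be the equivalence relation $\{(x,y)\in I\times I: x;1;y\neq 0\}$. A scaffold in $\mathfrak A$ is a system $\langle a_{xy}:(x,y)\in\mathcal E\rangle$ of atoms such that $a_{xy}\le x;1;y$, $a_{xx}=x$, $a_{yx}=a_{xy}^{\smile}$ and $a_{xz}\le a_{xy};a_{yz}$ for all $x\in I$ and all $(x,y),(y,z)\in\mathcal E$. The group pair $(G,\varphi)$ associated with it consists of $G=\langle G_x:x\in I\rangle$ and $\varphi=\langle\varphi_{xy}:(x,y)\in\mathcal E\rangle$, where $H_{xy}=\{f\in G_x:f;a_{xy}=a_{xy}\}$ and $K_{xy}=\{g\in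 G_y:a_{xy};g=a_{xy}\}$ (these are normal subgroups), and $\varphi_{xy}:G_x/H_{xy}\to G_y/K_{xy}$ is the isomorphism that maps the coset of $f$ to the coset of $g$ if and only if $f;a_{xy}=a_{xy};g$. **Theorem (Frame Theorem).** The group pair $(G,\varphi)$ associated with a scaffold in a measurable relation algebra is always a frame, that is: 1. $H_{xx}=K_{xx}=\{x\}$ and $\varphi_{xx}$ is the identity automorphism of $G_x/\{x\}$, for all $x\in I$; 2. $H_{yx}=K_{xy}$, $K_{yx}=H_{xy}$ and $\varphi_{yx}=\varphi_{xy}^{-1}$, whenever $(x,y)\in\mathcal E$; 3. $\varphi_{xy}[H_{xy};H_{xz}]=K_{xy};H_{yz}$ whenever $(x,y),(y,z)\in\mathcal E$; 4. whenever $(x,y),(y,z)\in\mathcal E$, the maps $\varphi_{xy},\varphi_{yz},\varphi_{xz}$ induce isomorphisms $$\hat\varphi_{xy}:G_x/(H_{xy};H_{xz})\to G_y/(K_{xy};H_{yz}),\quad \hat\varphi_{yz}:G_y/(K_{xy};H_{yz})\to G_z/(K_{xz};K_{yz}),\quad \hat\varphi_{xz}:G_x/(H_{xy};H_{xz})\to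 G_z/(K_{xz};K_{yz}),$$ and the composite of $\hat\varphi_{xy}$ followed by $\hat\varphi_{yz}$ equals $\hat\varphi_{xz}$ (no shifting by cosets is needed). -/

import Mathlib

/-! # Relation algebras -/

/-- A relation algebra: a Boolean algebra (`⊔` is addition, `ᶜ` is complement, `⊤` is the unit)
with relative multiplication `r ⨾ s`, converse `r˘` and an identity element. -/
class RelationAlgebra (A : Type*) extends BooleanAlgebra A where
  comp : A → A → A
  conv : A → A
  ident : A
  comp_assoc : ∀ r s t, comp r (comp s t) = comp (comp r s) t
  comp_ident : ∀ r, comp r ident = r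
  conv_conv : ∀ r, conv (conv r) = r
  conv_comp : ∀ r s, conv (comp r s) = comp (conv s) (conv r)
  sup_comp : ∀ r s t, comp (r ⊔ s) t = comp r t ⊔ comp s t
  conv_sup : ∀ r s, conv (r ⊔ s) = conv r ⊔ conv s
  tarski : ∀ r s, comp (conv r) (comp r s)ᶜ ⊔ sᶜ = sᶜ

infixl:75 " ⨾ " => RelationAlgebra.comp
postfix:max "˘" => RelationAlgebra.conv

namespace RelationAlgebra

section Arithmetic

variable {A : Type*} [RelationAlgebra A] {a b c r s t u x y z : A}

theorem conv_mono (h : r ≤ s) : r˘ ≤ s˘ := by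
  have := conv_sup r s
  rw [sup_eq_right.mpr h] at this
  rw [this]; exact le_sup_left

theorem le_conv (h : r˘ ≤ s) : r ≤ s˘ := by
  simpa [conv_conv] using conv_mono h

theorem conv_le (h : r ≤ s˘) : r˘ ≤ s := by
  simpa [conv_conv] using conv_mono h

theorem conv_bot : (⊥ : A)˘ = ⊥ := le_bot_iff.mp (conv_le bot_le)

theorem conv_top : (⊤ : A)˘ = ⊤ := top_le_iff.mp (le_conv le_top)

theorem conv_ne_bot (h : r ≠ ⊥) : r˘ ≠ ⊥ := fun h' => h (by
  rw [← conv_conv r, h', conv_bot])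

theorem conv_ident : (ident : A)˘ = ident := by
  have h1 : (ident : A)˘ ⨾ ident = ident˘ := comp_ident _
  have h2 := congrArg conv h1
  rw [conv_comp, conv_conv] at h2
  rw [← h1, h2]

theorem ident_comp (r : A) : ident ⨾ r = r := by
  have h := congrArg conv (comp_ident r˘)
  rwa [conv_comp, conv_conv, conv_ident] at h

theorem comp_sup (r s t : A) : r ⨾ (s ⊔ t) = r ⨾ s ⊔ r ⨾ t := by
  rw [← conv_conv (r ⨾ (s ⊔ t)), conv_comp, conv_sup, sup_comp, conv_sup, ← conv_comp,
    ← conv_comp, conv_conv, conv_conv]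

theorem comp_mono (h : r ≤ s) (h' : t ≤ u) : r ⨾ t ≤ s ⨾ u := by
  have h1 : r ⨾ t ≤ s ⨾ t := by
    rw [← sup_eq_right.mpr h, sup_comp]; exact le_sup_left
  have h2 : s ⨾ t ≤ s ⨾ u := by
    rw [← sup_eq_right.mpr h', comp_sup]; exact le_sup_left
  exact h1.trans h2

theorem cycle_aux (h : Disjoint (r ⨾ s) t) : Disjoint s (r˘ ⨾ t) := by
  have h1 : t ≤ (r ⨾ s)ᶜ := le_compl_iff_disjoint_left.mpr h
  have h2 : r˘ ⨾ (r ⨾ s)ᶜ ≤ sᶜ := sup_eq_right.mp (tarski r s)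
  exact le_compl_iff_disjoint_left.mp ((comp_mono le_rfl h1).trans h2)

theorem disjoint_conv (h : Disjoint r s) : Disjoint r˘ s˘ := by
  rw [disjoint_iff_inf_le] at h ⊢
  have h1 : (r˘ ⊓ s˘)˘ ≤ r ⊓ s := le_inf (conv_le inf_le_left) (conv_le inf_le_right)
  have h2 := le_conv (h1.trans h)
  rwa [conv_bot] at h2

/-- The cycle law. -/
theorem cycle_left : Disjoint (r ⨾ s) t ↔ Disjoint s (r˘ ⨾ t) := by
  refine ⟨cycle_aux, fun h => ?_⟩
  have := cycle_aux h.symm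
  rw [conv_conv] at this
  exact this.symm

/-- The cycle law, right-hand version. -/
theorem cycle_right : Disjoint (r ⨾ s) t ↔ Disjoint r (t ⨾ s˘) := by
  have key : ∀ p q : A, Disjoint p q ↔ Disjoint p˘ q˘ := fun p q =>
    ⟨disjoint_conv, fun h => by simpa [conv_conv] using disjoint_conv h⟩
  rw [key, conv_comp, cycle_left, key, conv_comp, conv_conv, conv_conv, conv_conv]

theorem comp_bot (r : A) : r ⨾ ⊥ = ⊥ := by
  have h : Disjoint (r ⨾ ⊥) (⊤ : A) := cycle_left.mpr disjoint_bot_left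
  exact disjoint_top.mp h

theorem bot_comp (r : A) : ⊥ ⨾ r = ⊥ := by
  have h : Disjoint (⊥ ⨾ r) (⊤ : A) := cycle_right.mpr disjoint_bot_left
  exact disjoint_top.mp h

theorem comp_inf_le (r s t : A) : r ⨾ s ⊓ t ≤ r ⨾ (s ⊓ r˘ ⨾ t) := by
  have h1 : r ⨾ s = r ⨾ (s ⊓ r˘ ⨾ t) ⊔ r ⨾ (s ⊓ (r˘ ⨾ t)ᶜ) := by
    rw [← comp_sup, ← inf_sup_left, sup_compl_eq_top, inf_top_eq]
  have h2 : Disjoint (r ⨾ (s ⊓ (r˘ ⨾ t)ᶜ)) t :=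
    cycle_left.mpr (disjoint_compl_left.mono_left inf_le_right)
  rw [h1, inf_sup_right, h2.eq_bot, sup_bot_eq]
  exact inf_le_left

theorem le_comp_conv_comp (r : A) : r ≤ r ⨾ r˘ ⨾ r := by
  have h := comp_inf_le r ident r
  rw [comp_ident, inf_idem] at h
  rw [← comp_assoc]
  exact h.trans (comp_mono le_rfl inf_le_right)

theorem conv_of_le_ident (hx : x ≤ ident) : x˘ = x := by
  have key : ∀ w : A, w ≤ ident → w ≤ w˘ := fun w hw =>
    (le_comp_conv_comp w).trans (by
      have := comp_mono (comp_mono hw (le_refl w˘)) hw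
      rwa [ident_comp, comp_ident] at this)
  exact le_antisymm (conv_le (key x hx)) (key x hx)

theorem comp_self_of_le_ident (hx : x ≤ ident) : x ⨾ x = x := by
  have h1 : ∀ w : A, w ⨾ x ≤ w := fun w => by
    have := comp_mono (le_refl w) hx
    rwa [comp_ident] at this
  refine le_antisymm (h1 x) ?_
  have h2 := le_comp_conv_comp x
  rw [conv_of_le_ident hx] at h2
  exact h2.trans (h1 _)

theorem conv_rect (hx : x ≤ ident) (hy : y ≤ ident) : (x ⨾ ⊤ ⨾ y)˘ = y ⨾ ⊤ ⨾ x := by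
  rw [conv_comp, conv_comp, conv_top, conv_of_le_ident hx, conv_of_le_ident hy, comp_assoc]

theorem rect_comp_rect_le : x ⨾ ⊤ ⨾ y ⨾ (y ⨾ ⊤ ⨾ z) ≤ x ⨾ ⊤ ⨾ z := by
  have h : x ⨾ ⊤ ⨾ y ⨾ (y ⨾ ⊤ ⨾ z) = x ⨾ (⊤ ⨾ y ⨾ y ⨾ ⊤) ⨾ z := by simp only [comp_assoc]
  rw [h]
  exact comp_mono (comp_mono le_rfl le_top) le_rfl

theorem comp_le_rect (ha : a ≤ x ⨾ ⊤ ⨾ y) (hb : b ≤ y ⨾ ⊤ ⨾ z) : a ⨾ b ≤ x ⨾ ⊤ ⨾ z :=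
  (comp_mono ha hb).trans rect_comp_rect_le

theorem conv_le_rect (hx : x ≤ ident) (hy : y ≤ ident) (ha : a ≤ x ⨾ ⊤ ⨾ y) :
    a˘ ≤ y ⨾ ⊤ ⨾ x := by
  rw [← conv_rect hx hy]; exact conv_mono ha

theorem side_comp (hx : x ≤ ident) (ha : a ≤ x ⨾ ⊤ ⨾ y) : x ⨾ a = a := by
  apply le_antisymm
  · have := comp_mono hx (le_refl a)
    rwa [ident_comp] at this
  · have h := comp_inf_le x (⊤ ⨾ y) a
    rw [comp_assoc, inf_eq_right.mpr ha, conv_of_le_ident hx] at h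
    refine h.trans ((comp_mono le_rfl inf_le_right).trans ?_)
    rw [comp_assoc, comp_self_of_le_ident hx]

theorem comp_side (hx : x ≤ ident) (hy : y ≤ ident) (ha : a ≤ x ⨾ ⊤ ⨾ y) : a ⨾ y = a := by
  have h := congrArg conv (side_comp hy (conv_le_rect hx hy ha))
  rwa [conv_comp, conv_conv, conv_of_le_ident hy] at h

theorem side_le_comp_conv (hx : x ≤ ident) (hx' : IsAtom x) (ha : a ≤ x ⨾ ⊤ ⨾ y) (h0 : a ≠ ⊥) :
    x ≤ a ⨾ a˘ := by
  by_contra hcon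
  have h1 : Disjoint x (a ⨾ a˘) := hx'.not_le_iff_disjoint.mp hcon
  have h2 := cycle_right.mpr h1
  rw [side_comp hx ha, disjoint_self] at h2
  exact h0 h2

theorem side_le_conv_comp (hx : x ≤ ident) (hy : y ≤ ident) (hy' : IsAtom y)
    (ha : a ≤ x ⨾ ⊤ ⨾ y) (h0 : a ≠ ⊥) : y ≤ a˘ ⨾ a := by
  have := side_le_comp_conv hy hy' (conv_le_rect hx hy ha) (conv_ne_bot h0)
  rwa [conv_conv] at this

theorem comp_ne_bot (hx : x ≤ ident) (hy : y ≤ ident) (hy' : IsAtom y)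
    (ha : a ≤ x ⨾ ⊤ ⨾ y) (hb : b ≤ y ⨾ ⊤ ⨾ z) (ha0 : a ≠ ⊥) (hb0 : b ≠ ⊥) : a ⨾ b ≠ ⊥ := by
  intro h
  have h1 : y ⨾ b ≤ a˘ ⨾ a ⨾ b := comp_mono (side_le_conv_comp hx hy hy' ha ha0) le_rfl
  rw [side_comp hy hb, ← comp_assoc, h, comp_bot] at h1
  exact hb0 (le_bot_iff.mp h1)

theorem isAtom_conv (h : IsAtom a) : IsAtom a˘ := by
  refine ⟨conv_ne_bot h.1, fun b hb => ?_⟩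
  have h1 : b˘ < a := lt_of_le_of_ne (conv_le hb.le) (fun e => hb.ne (by rw [← e, conv_conv]))
  rw [← conv_conv b, h.2 _ h1, conv_bot]

end Arithmetic

/-! # Measurable atoms and their groups -/

section Measurable

variable {A : Type*} [RelationAlgebra A]

/-- `f` is a function (functional element). -/
def IsFunctional (f : A) : Prop := f˘ ⨾ f ≤ ident

/-- A subidentity atom `x` is measurable if the square `x ⨾ ⊤ ⨾ x` is a sum of functions. -/
structure IsMeasurableAtom (x : A) : Prop where
  isAtom : IsAtom x
  le_ident : x ≤ ident
  isLUB : ∃ F : Set A, (∀ f ∈ F, IsFunctional f) ∧ IsLUB F (x ⨾ ⊤ ⨾ x)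

variable (A) in
/-- A relation algebra is measurable if its identity element is a sum of measurable atoms. -/
def IsMeasurable : Prop :=
  ∃ S : Set A, (∀ x ∈ S, IsMeasurableAtom x) ∧ IsLUB S (ident : A)

variable (A) in
/-- The set `I` of measurable atoms, as a type. -/
abbrev MeasurableAtom : Type _ := {x : A // IsMeasurableAtom x}

/-- The rectangle `x ⨾ ⊤ ⨾ y`. -/
abbrev rect (x y : MeasurableAtom A) : A := x.1 ⨾ ⊤ ⨾ y.1

/-- The set of nonzero functions below the square on `x`. -/
def permGroup (x : MeasurableAtom A) : Set A :=
  {f | f ≠ ⊥ ∧ f ≤ rect x x ∧ IsFunctional f}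

theorem isAtom_of_mem_permGroup {x : MeasurableAtom A} {f : A} (hf : f ∈ permGroup x) :
    IsAtom f := by
  refine ⟨hf.1, fun g hg => ?_⟩
  by_contra h0
  have h1 := side_le_comp_conv x.2.le_ident x.2.isAtom (hg.le.trans hf.2.1) h0
  have h2 : f ≤ g := calc
    f = x.1 ⨾ f := (side_comp x.2.le_ident hf.2.1).symm
    _ ≤ g ⨾ g˘ ⨾ f := comp_mono h1 le_rfl
    _ ≤ g ⨾ f˘ ⨾ f := comp_mono (comp_mono le_rfl (conv_mono hg.le)) le_rfl
    _ = g ⨾ (f˘ ⨾ f) := (comp_assoc _ _ _).symm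
    _ ≤ g ⨾ ident := comp_mono le_rfl hf.2.2
    _ = g := comp_ident g
  exact absurd h2 hg.not_ge

theorem exists_permGroup_not_disjoint {x : MeasurableAtom A} {b : A} (hb : b ≤ rect x x)
    (hb0 : b ≠ ⊥) : ∃ g ∈ permGroup x, ¬ Disjoint g b := by
  obtain ⟨F, hF, hlub⟩ := x.2.isLUB
  by_contra! hcon
  apply hb0
  have h1 : rect x x ≤ bᶜ := by
    refine hlub.2 fun g hg => le_compl_iff_disjoint_right.mpr ?_
    by_cases h0 : g = ⊥
    · rw [h0]; exact disjoint_bot_left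
    · exact hcon g ⟨h0, hlub.1 hg, hF g hg⟩
  exact disjoint_self.mp (le_compl_iff_disjoint_right.mp (hb.trans h1))

theorem mul_mem_permGroup {x : MeasurableAtom A} {f g : A} (hf : f ∈ permGroup x)
    (hg : g ∈ permGroup x) : f ⨾ g ∈ permGroup x := by
  refine ⟨comp_ne_bot x.2.le_ident x.2.le_ident x.2.isAtom hf.2.1 hg.2.1 hf.1 hg.1,
    comp_le_rect hf.2.1 hg.2.1, ?_⟩
  have h1 : (f ⨾ g)˘ ⨾ (f ⨾ g) = g˘ ⨾ (f˘ ⨾ f) ⨾ g := by simp only [conv_comp, comp_assoc]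
  have h2 : g˘ ⨾ (f˘ ⨾ f) ⨾ g ≤ g˘ ⨾ ident ⨾ g := comp_mono (comp_mono le_rfl hf.2.2) le_rfl
  unfold IsFunctional
  rw [h1]
  refine h2.trans ?_
  rw [comp_ident]; exact hg.2.2

theorem one_mem_permGroup (x : MeasurableAtom A) : x.1 ∈ permGroup x := by
  have hx := x.2.le_ident
  refine ⟨x.2.isAtom.1, ?_, ?_⟩
  · have h : x.1 ⨾ x.1 ⨾ x.1 ≤ x.1 ⨾ ⊤ ⨾ x.1 := comp_mono (comp_mono le_rfl le_top) le_rfl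
    rwa [comp_self_of_le_ident hx, comp_self_of_le_ident hx] at h
  · unfold IsFunctional
    rw [conv_of_le_ident hx, comp_self_of_le_ident hx]; exact hx

theorem inv_mem_permGroup {x : MeasurableAtom A} {f : A} (hf : f ∈ permGroup x) :
    f˘ ∈ permGroup x := by
  have hr : f˘ ≤ rect x x := conv_le_rect x.2.le_ident x.2.le_ident hf.2.1
  refine ⟨conv_ne_bot hf.1, hr, ?_⟩
  obtain ⟨g, hg, hgf⟩ := exists_permGroup_not_disjoint hr (conv_ne_bot hf.1)
  have hle : f˘ ≤ g := by
    by_contra hcon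
    exact hgf ((isAtom_conv (isAtom_of_mem_permGroup hf)).not_le_iff_disjoint.mp hcon).symm
  exact (comp_mono (conv_mono hle) hle).trans hg.2.2

theorem conv_comp_permGroup {x : MeasurableAtom A} {f : A} (hf : f ∈ permGroup x) :
    f˘ ⨾ f = x.1 := by
  have hx := x.2.le_ident
  refine le_antisymm ?_ (side_le_conv_comp hx hx x.2.isAtom hf.2.1 hf.1)
  have h1 : f˘ ⨾ f ≤ rect x x := comp_le_rect (conv_le_rect hx hx hf.2.1) hf.2.1
  rw [← side_comp hx h1]
  exact (comp_mono le_rfl hf.2.2).trans_eq (comp_ident _)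

/-- The group `G_x`: its operations are relative multiplication and converse, its unit is `x`. -/
instance permGroup.instGroup (x : MeasurableAtom A) : Group (permGroup x) where
  mul f g := ⟨f.1 ⨾ g.1, mul_mem_permGroup f.2 g.2⟩
  one := ⟨x.1, one_mem_permGroup x⟩
  inv f := ⟨f.1˘, inv_mem_permGroup f.2⟩
  mul_assoc f g h := Subtype.ext (comp_assoc f.1 g.1 h.1).symm
  one_mul f := Subtype.ext (side_comp x.2.le_ident f.2.2.1)
  mul_one f := Subtype.ext (comp_side x.2.le_ident x.2.le_ident f.2.2.1)
  inv_mul_cancel f := Subtype.ext (conv_comp_permGroup f.2)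

theorem permGroup.coe_mul {x : MeasurableAtom A} (f g : permGroup x) :
    ((f * g : permGroup x) : A) = f.1 ⨾ g.1 := rfl

theorem permGroup.coe_one (x : MeasurableAtom A) : ((1 : permGroup x) : A) = x.1 := rfl

theorem permGroup.coe_inv {x : MeasurableAtom A} (f : permGroup x) :
    ((f⁻¹ : permGroup x) : A) = f.1˘ := rfl

theorem permGroup_disjoint {x y : MeasurableAtom A} (h : x ≠ y) :
    Disjoint (permGroup x) (permGroup y) := by
  rw [Set.disjoint_left]
  intro f hf hf'
  apply h
  have h1 : f˘ ⨾ f = x.1 := conv_comp_permGroup hf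
  have h2 : f˘ ⨾ f = y.1 := conv_comp_permGroup hf'
  exact Subtype.ext (h1.symm.trans h2)

variable (A) in
/-- The equivalence relation `E` on the set of measurable atoms: `x ⨾ ⊤ ⨾ y ≠ 0`. -/
def atomSetoid : Setoid (MeasurableAtom A) where
  r x y := rect x y ≠ ⊥
  iseqv :=
    { refl := fun x h => x.2.isAtom.1 (le_bot_iff.mp (h ▸ (one_mem_permGroup x).2.1))
      symm := fun {x y} h => by
        have := conv_ne_bot h
        rwa [conv_rect x.2.le_ident y.2.le_ident] at this
      trans := fun {x y z} h h' h0 => by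
        refine comp_ne_bot x.2.le_ident y.2.le_ident y.2.isAtom le_rfl le_rfl h h' ?_
        exact le_bot_iff.mp (h0 ▸ rect_comp_rect_le) }

/-! # Stabilizers and the quotient isomorphism determined by an atom -/

variable {x y : MeasurableAtom A} {a : A}

/-- The left stabilizer `H_a = {f ∈ G_x : f ⨾ a = a}` of an element `a ≤ x ⨾ ⊤ ⨾ y`. -/
def leftStab (ha : a ≤ rect x y) : Subgroup (permGroup x) where
  carrier := {f | f.1 ⨾ a = a}
  mul_mem' {f g} hf hg := by
    change f.1 ⨾ g.1 ⨾ a = a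
    rw [← comp_assoc, show g.1 ⨾ a = a from hg, show f.1 ⨾ a = a from hf]
  one_mem' := side_comp x.2.le_ident ha
  inv_mem' {f} hf := by
    change f.1˘ ⨾ a = a
    conv_lhs => rw [← show f.1 ⨾ a = a from hf]
    rw [comp_assoc, conv_comp_permGroup f.2, side_comp x.2.le_ident ha]

/-- The right stabilizer `K_a = {g ∈ G_y : a ⨾ g = a}` of an element `a ≤ x ⨾ ⊤ ⨾ y`. -/
def rightStab (ha : a ≤ rect x y) : Subgroup (permGroup y) where
  carrier := {g | a ⨾ g.1 = a}
  mul_mem' {f g} hf hg := by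
    change a ⨾ (f.1 ⨾ g.1) = a
    rw [comp_assoc, show a ⨾ f.1 = a from hf, show a ⨾ g.1 = a from hg]
  one_mem' := comp_side x.2.le_ident y.2.le_ident ha
  inv_mem' {g} hg := by
    change a ⨾ g.1˘ = a
    conv_lhs => rw [← show a ⨾ g.1 = a from hg]
    have h : g.1 ⨾ g.1˘ = y.1 := congrArg Subtype.val (mul_inv_cancel g)
    rw [← comp_assoc, h, comp_side x.2.le_ident y.2.le_ident ha]

theorem mem_leftStab {ha : a ≤ rect x y} {f : permGroup x} :
    f ∈ leftStab ha ↔ f.1 ⨾ a = a := Iff.rfl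

theorem mem_rightStab {ha : a ≤ rect x y} {g : permGroup y} :
    g ∈ rightStab ha ↔ a ⨾ g.1 = a := Iff.rfl

theorem isAtom_comp_right (ha : a ≤ rect x y) (h : IsAtom a) (g : permGroup y) :
    IsAtom (a ⨾ g.1) := by
  have hx := x.2.le_ident
  have hy := y.2.le_ident
  refine ⟨comp_ne_bot hx hy y.2.isAtom ha g.2.2.1 h.1 g.2.1, fun c hc => ?_⟩
  by_contra h0
  have h1 : g.1 ⨾ g.1˘ = y.1 := congrArg Subtype.val (mul_inv_cancel g)
  have hcr : c ≤ rect x y := hc.le.trans (comp_le_rect ha g.2.2.1)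
  have h2 : c ⨾ g.1˘ ≤ a := by
    refine (comp_mono hc.le le_rfl).trans_eq ?_
    rw [← comp_assoc, h1, comp_side hx hy ha]
  have h3 : c ⨾ g.1˘ ≠ ⊥ := comp_ne_bot hx hy y.2.isAtom hcr
    (conv_le_rect hy hy g.2.2.1) h0 (conv_ne_bot g.2.1)
  have h4 : c ⨾ g.1˘ = a := (h.le_iff_eq h3).mp h2
  apply hc.ne
  rw [← h4, ← comp_assoc, conv_comp_permGroup g.2, comp_side hx hy hcr]

theorem isAtom_comp_left (ha : a ≤ rect x y) (h : IsAtom a) (f : permGroup x) :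
    IsAtom (f.1 ⨾ a) := by
  have h1 := isAtom_conv (isAtom_comp_right (conv_le_rect x.2.le_ident y.2.le_ident ha)
    (isAtom_conv h) f⁻¹)
  rwa [permGroup.coe_inv, ← conv_comp, conv_conv] at h1

theorem exists_comp_eq (ha : a ≤ rect x y) (h : IsAtom a) (f : permGroup x) :
    ∃ g : permGroup y, f.1 ⨾ a = a ⨾ g.1 := by
  have hx := x.2.le_ident
  have hy := y.2.le_ident
  have hfa := isAtom_comp_left ha h f
  have hfr : f.1 ⨾ a ≤ rect x y := comp_le_rect f.2.2.1 ha
  obtain ⟨g, hg, hd⟩ := exists_permGroup_not_disjoint (x := y) (b := a˘ ⨾ (f.1 ⨾ a))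
    (comp_le_rect (conv_le_rect hx hy ha) hfr)
    (comp_ne_bot hy hx x.2.isAtom (conv_le_rect hx hy ha) hfr (conv_ne_bot h.1) hfa.1)
  refine ⟨⟨g, hg⟩, ?_⟩
  have h1 : ¬ Disjoint (a ⨾ g) (f.1 ⨾ a) := fun h' => hd (cycle_left.mp h')
  by_contra hne
  exact h1 ((isAtom_comp_right ha h ⟨g, hg⟩).disjoint_of_ne hfa (Ne.symm hne))

theorem exists_comp_eq' (ha : a ≤ rect x y) (h : IsAtom a) (g : permGroup y) :
    ∃ f : permGroup x, f.1 ⨾ a = a ⨾ g.1 := by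
  obtain ⟨f, hf⟩ := exists_comp_eq (conv_le_rect x.2.le_ident y.2.le_ident ha) (isAtom_conv h) g⁻¹
  refine ⟨f⁻¹, ?_⟩
  have := congrArg conv hf
  rw [permGroup.coe_inv, conv_comp, conv_comp, conv_conv, conv_conv] at this
  exact this.symm

theorem leftStab_normal (ha : a ≤ rect x y) (h : IsAtom a) : (leftStab ha).Normal := by
  refine ⟨fun f hf g => ?_⟩
  obtain ⟨k, hk⟩ := exists_comp_eq ha h g⁻¹
  rw [mem_leftStab] at hf ⊢
  have h1 : g.1 ⨾ (g⁻¹ : permGroup x).1 = x.1 := congrArg Subtype.val (mul_inv_cancel g)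
  rw [permGroup.coe_mul, permGroup.coe_mul, ← comp_assoc, hk, ← comp_assoc, comp_assoc f.1, hf,
    ← hk, comp_assoc, h1, side_comp x.2.le_ident ha]

theorem rightStab_normal (ha : a ≤ rect x y) (h : IsAtom a) : (rightStab ha).Normal := by
  refine ⟨fun f hf g => ?_⟩
  obtain ⟨k, hk⟩ := exists_comp_eq' ha h g
  rw [mem_rightStab] at hf ⊢
  have h1 : g.1 ⨾ (g⁻¹ : permGroup y).1 = y.1 := congrArg Subtype.val (mul_inv_cancel g)
  rw [permGroup.coe_mul, permGroup.coe_mul, comp_assoc, comp_assoc, ← hk, ← comp_assoc k.1, hf,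
    hk, ← comp_assoc, h1, comp_side x.2.le_ident y.2.le_ident ha]

theorem mk_rightStab_eq (ha : a ≤ rect x y) (h : IsAtom a) (g g' : permGroup y) :
    (g : permGroup y ⧸ rightStab ha) = g' ↔ a ⨾ g.1 = a ⨾ g'.1 := by
  have hn := rightStab_normal ha h
  rw [eq_comm, QuotientGroup.eq, hn.mem_comm_iff, mem_rightStab, permGroup.coe_mul,
    permGroup.coe_inv, comp_assoc]
  have h1 : g'.1 ⨾ g'.1˘ = y.1 := congrArg Subtype.val (mul_inv_cancel g')
  have hs := comp_side x.2.le_ident y.2.le_ident ha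
  constructor
  · intro e
    have e' : a ⨾ g.1 ⨾ g'.1˘ ⨾ g'.1 = a ⨾ g'.1 := congrArg (fun r => r ⨾ g'.1) e
    rwa [← comp_assoc, conv_comp_permGroup g'.2,
      comp_side x.2.le_ident y.2.le_ident (comp_le_rect ha g.2.2.1)] at e'
  · intro e
    rw [e, ← comp_assoc, h1, hs]

/-- The homomorphism `G_x → G_y / K_a` that takes `f` to the coset of those `g` with
`f ⨾ a = a ⨾ g`. -/
noncomputable def atomHom (ha : a ≤ rect x y) (h : IsAtom a) :
    haveI := rightStab_normal ha h
    permGroup x →* permGroup y ⧸ rightStab ha :=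
  haveI := rightStab_normal ha h
  MonoidHom.mk' (fun f => ((exists_comp_eq ha h f).choose : permGroup y ⧸ rightStab ha))
    (fun f f' => by
      rw [← QuotientGroup.mk_mul, mk_rightStab_eq ha h]
      refine (exists_comp_eq ha h (f * f')).choose_spec.symm.trans ?_
      have e1 := (exists_comp_eq ha h f).choose_spec
      have e2 := (exists_comp_eq ha h f').choose_spec
      calc f.1 ⨾ f'.1 ⨾ a = f.1 ⨾ (f'.1 ⨾ a) := (comp_assoc _ _ _).symm
        _ = f.1 ⨾ a ⨾ _ := (congrArg (f.1 ⨾ ·) e2).trans (comp_assoc _ _ _)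
        _ = _ := (congrArg (· ⨾ _) e1).trans (comp_assoc _ _ _).symm)

theorem atomHom_eq_iff (ha : a ≤ rect x y) (h : IsAtom a) (f : permGroup x) (g : permGroup y) :
    atomHom ha h f = (g : permGroup y ⧸ rightStab ha) ↔ f.1 ⨾ a = a ⨾ g.1 := by
  have e := (exists_comp_eq ha h f).choose_spec
  refine (mk_rightStab_eq ha h (exists_comp_eq ha h f).choose g).trans ?_
  exact ⟨fun e' => e.trans e', fun e' => e.symm.trans e'⟩

theorem atomHom_surjective (ha : a ≤ rect x y) (h : IsAtom a) :
    Function.Surjective (atomHom ha h) := by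
  intro q
  obtain ⟨g, rfl⟩ := QuotientGroup.mk_surjective q
  obtain ⟨f, hf⟩ := exists_comp_eq' ha h g
  exact ⟨f, (atomHom_eq_iff ha h f g).mpr hf⟩

theorem atomHom_ker (ha : a ≤ rect x y) (h : IsAtom a) :
    haveI := rightStab_normal ha h
    leftStab ha = (atomHom ha h).ker := by
  have := rightStab_normal ha h
  ext f
  rw [MonoidHom.mem_ker, ← QuotientGroup.mk_one, atomHom_eq_iff, mem_leftStab,
    permGroup.coe_one, comp_side x.2.le_ident y.2.le_ident ha]

/-- The isomorphism `φ_a : G_x / H_a ≃ G_y / K_a` determined by an atom `a ≤ x ⨾ ⊤ ⨾ y`. -/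
noncomputable def atomIso (ha : a ≤ rect x y) (h : IsAtom a) :
    haveI := leftStab_normal ha h
    haveI := rightStab_normal ha h
    permGroup x ⧸ leftStab ha ≃* permGroup y ⧸ rightStab ha :=
  haveI := leftStab_normal ha h
  haveI := rightStab_normal ha h
  (QuotientGroup.quotientMulEquivOfEq (atomHom_ker ha h)).trans
    (QuotientGroup.quotientKerEquivOfSurjective (atomHom ha h) (atomHom_surjective ha h))

/-- `φ_a` maps the coset of `f` to the coset of `g` exactly when `f ⨾ a = a ⨾ g`. -/
theorem atomIso_eq_iff (ha : a ≤ rect x y) (h : IsAtom a) (f : permGroup x) (g : permGroup y) :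
    atomIso ha h (f : permGroup x ⧸ leftStab ha) = (g : permGroup y ⧸ rightStab ha) ↔
      f.1 ⨾ a = a ⨾ g.1 :=
  atomHom_eq_iff ha h f g

end Measurable

end RelationAlgebra

/-! # Group pairs and frames -/

/-- A group pair: a system of pairwise disjoint groups (realized on subsets of a type `U`) indexed
by `I`, and a system of isomorphisms `φ x y` between quotients of these groups, indexed by the
pairs `(x, y)` in an equivalence relation on `I`. -/
structure GroupPair (I U : Type*) where
  carrier : I → Set U
  group : ∀ x, Group (carrier x)
  disjoint : ∀ x y, x ≠ y → Disjoint (carrier x) (carrier y)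
  E : Setoid I
  H : ∀ x y, E x y → Subgroup (carrier x)
  K : ∀ x y, E x y → Subgroup (carrier y)
  H_normal : ∀ x y h, (H x y h).Normal
  K_normal : ∀ x y h, (K x y h).Normal
  φ : ∀ x y h, carrier x ⧸ H x y h ≃* carrier y ⧸ K x y h

attribute [instance] GroupPair.group GroupPair.H_normal GroupPair.K_normal

/-- An isomorphism `φ : G / H ≃ G' / K` induces an isomorphism `G / M ≃ G' / N`, where `M ⊇ H` and
`N ⊇ K`, if it maps the subgroup `M / H` onto the subgroup `N / K`. -/
structure Induces {G G' : Type*} [Group G] [Group G'] {H : Subgroup G} {K : Subgroup G'}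
    [H.Normal] [K.Normal] (φ : G ⧸ H ≃* G' ⧸ K) (M : Subgroup G) (N : Subgroup G') : Prop where
  left_le : H ≤ M
  right_le : K ≤ N
  map_eq : (M.map (QuotientGroup.mk' H)).map φ.toMonoidHom = N.map (QuotientGroup.mk' K)

/-- The isomorphism `G / M ≃ G' / N` induced by `φ : G / H ≃ G' / K`. -/
noncomputable def inducedIso {G G' : Type*} [Group G] [Group G'] {H : Subgroup G}
    {K : Subgroup G'} [H.Normal] [K.Normal] {φ : G ⧸ H ≃* G' ⧸ K} {M : Subgroup G}
    {N : Subgroup G'} [M.Normal] [N.Normal] (h : Induces φ M N) : G ⧸ M ≃* G' ⧸ N :=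
  (QuotientGroup.quotientQuotientEquivQuotient H M h.left_le).symm.trans
    ((QuotientGroup.congr _ _ φ h.map_eq).trans
      (QuotientGroup.quotientQuotientEquivQuotient K N h.right_le))

/-- The induced isomorphism maps the coset `M f` to `N g` whenever `φ` maps `H f` to `K g`. -/
theorem inducedIso_mk {G G' : Type*} [Group G] [Group G'] {H : Subgroup G}
    {K : Subgroup G'} [H.Normal] [K.Normal] {φ : G ⧸ H ≃* G' ⧸ K} {M : Subgroup G}
    {N : Subgroup G'} [M.Normal] [N.Normal] (h : Induces φ M N) {f : G} {g : G'}
    (hfg : φ (f : G ⧸ H) = (g : G' ⧸ K)) : inducedIso h (f : G ⧸ M) = (g : G' ⧸ N) := by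
  have h1 : (QuotientGroup.quotientQuotientEquivQuotient H M h.left_le).symm (f : G ⧸ M) =
      (((f : G ⧸ H) : (G ⧸ H) ⧸ M.map (QuotientGroup.mk' H))) := by
    rw [MulEquiv.symm_apply_eq]; rfl
  have h2 : inducedIso h (f : G ⧸ M) = QuotientGroup.quotientQuotientEquivQuotient K N h.right_le
      ((φ (f : G ⧸ H) : G' ⧸ K) : (G' ⧸ K) ⧸ N.map (QuotientGroup.mk' K)) := by
    unfold inducedIso
    rw [MulEquiv.trans_apply, h1]
    rfl
  rw [h2, hfg]
  rfl

/-- The frame conditions. The product of two normal subgroups is their join `⊔`. -/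
structure GroupPair.IsFrame {I U : Type*} (F : GroupPair I U) : Prop where
  /-- `φ x x` is the identity automorphism of `G x / {e}`. -/
  refl : ∀ x (h : F.E x x), ∃ (hH : F.H x x h = ⊥) (hK : F.K x x h = ⊥),
    F.φ x x h = QuotientGroup.quotientMulEquivOfEq (hH.trans hK.symm)
  /-- `φ y x` is the inverse of `φ x y`. -/
  symm : ∀ x y (h : F.E x y) (h' : F.E y x),
    ∃ (hH : F.H y x h' = F.K x y h) (hK : F.H x y h = F.K y x h'),
      F.φ y x h' = (QuotientGroup.quotientMulEquivOfEq hH).trans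
        ((F.φ x y h).symm.trans (QuotientGroup.quotientMulEquivOfEq hK))
  /-- `φ x y` maps `H x y ∘ H x z` onto `K x y ∘ H y z`. -/
  image : ∀ x y z (hxy : F.E x y) (hyz : F.E y z) (hxz : F.E x z),
    ((F.H x y hxy ⊔ F.H x z hxz).map (QuotientGroup.mk' (F.H x y hxy))).map
        (F.φ x y hxy).toMonoidHom =
      (F.K x y hxy ⊔ F.H y z hyz).map (QuotientGroup.mk' (F.K x y hxy))
  /-- `φ x y`, `φ y z`, `φ x z` induce isomorphisms between the quotients by the product
  subgroups, and the composite of the first two induced isomorphisms is the third. -/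
  comp : ∀ x y z (hxy : F.E x y) (hyz : F.E y z) (hxz : F.E x z),
    ∃ (i : Induces (F.φ x y hxy) (F.H x y hxy ⊔ F.H x z hxz) (F.K x y hxy ⊔ F.H y z hyz))
      (j : Induces (F.φ y z hyz) (F.K x y hxy ⊔ F.H y z hyz) (F.K x z hxz ⊔ F.K y z hyz))
      (k : Induces (F.φ x z hxz) (F.H x y hxy ⊔ F.H x z hxz) (F.K x z hxz ⊔ F.K y z hyz)),
      (inducedIso i).trans (inducedIso j) = inducedIso k

/-! # Scaffolds -/

namespace RelationAlgebra

/-- A semi-scaffold: a system of atoms `a x y`, indexed by the pairs `(x, y)` of measurable atoms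
with `x ⨾ ⊤ ⨾ y ≠ 0`. -/
structure SemiScaffold (A : Type*) [RelationAlgebra A] where
  a : ∀ x y : MeasurableAtom A, atomSetoid A x y → A
  isAtom : ∀ x y h, IsAtom (a x y h)
  le_rect : ∀ x y h, a x y h ≤ rect x y
  refl : ∀ x (h : atomSetoid A x x), a x x h = x.1
  symm : ∀ x y (h : atomSetoid A x y) (h' : atomSetoid A y x), a y x h' = (a x y h)˘

/-- A scaffold: a semi-scaffold with `a x z ≤ a x y ⨾ a y z`. -/
structure Scaffold (A : Type*) [RelationAlgebra A] extends SemiScaffold A where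
  trans : ∀ x y z (hxy : atomSetoid A x y) (hyz : atomSetoid A y z) (hxz : atomSetoid A x z),
    a x z hxz ≤ a x y hxy ⨾ a y z hyz

/-- The group pair associated with a (semi-)scaffold `a`: the groups are the groups of nonzero
functions below the squares on measurable atoms, and `φ x y` is the isomorphism determined by the
atom `a x y`. -/
noncomputable def SemiScaffold.groupPair {A : Type*} [RelationAlgebra A] (S : SemiScaffold A) :
    GroupPair (MeasurableAtom A) A where
  carrier := permGroup
  group := permGroup.instGroup
  disjoint _ _ h := permGroup_disjoint h
  E := atomSetoid A
  H x y h := leftStab (S.le_rect x y h)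
  K x y h := rightStab (S.le_rect x y h)
  H_normal x y h := leftStab_normal (S.le_rect x y h) (S.isAtom x y h)
  K_normal x y h := rightStab_normal (S.le_rect x y h) (S.isAtom x y h)
  φ x y h := atomIso (S.le_rect x y h) (S.isAtom x y h)

end RelationAlgebra

namespace RelationAlgebra

/-! ### Stabilizers of single atoms and their products -/

section Measurable

variable {A : Type*} [RelationAlgebra A] {x y z : MeasurableAtom A} {a b c : A}

/-! Each frame condition becomes a statement about the relation `f ⨾ a = a ⨾ g`, which says that
`φ_a` carries the coset of `f` to the coset of `g`. Taking converses turns `a` into `a˘` and swaps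
`f` with `g`, which gives the symmetry condition; for `a = x` the relation reads `f = g`, which
gives the reflexivity condition.

The conditions on triples rest on one criterion, `mem_rightStab_sup_leftStab`: `g` lies in `K_a H_b`
as soon as `a ⨾ g ⨾ b` meets `a ⨾ b`. To show that some group element lies in a product of
stabilizers it is thus enough to find a nonzero element below two products, and the inequality `a_xz
≤ a_xy ⨾ a_yz` supplies one. For the image condition it is `a_xz` itself (`mem_sup_of_comp_eq`). For
the composition condition, the two images `h`, `h'` of `f` in `G_z` satisfy `a_xz ⨾ h' ⨾ h˘ ≤ a_xy ⨾
a_yz`, and the inequality for the triple `(x, z, y)` then makes the required products meet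
(`mul_inv_mem_sup`). This is why no coset shift occurs. -/

theorem permGroup.comp_conv {x : MeasurableAtom A} (f : permGroup x) : f.1 ⨾ f.1˘ = x.1 :=
  congrArg Subtype.val (mul_inv_cancel f)

/-- The relation `f ⨾ a = a ⨾ g` passes to inverses and converses. -/
theorem comp_conv_eq_conv_comp (ha : a ≤ rect x y) {f : permGroup x} {g : permGroup y}
    (h : f.1 ⨾ a = a ⨾ g.1) : g.1 ⨾ a˘ = a˘ ⨾ f.1 := by
  have hx := x.2.le_ident
  have hy := y.2.le_ident
  -- The relation is first passed to inverses; the converse of the result is then the claim.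
  have e : f.1˘ ⨾ a = a ⨾ g.1˘ := calc
    f.1˘ ⨾ a = f.1˘ ⨾ (a ⨾ (g.1 ⨾ g.1˘)) := by rw [permGroup.comp_conv, comp_side hx hy ha]
    _ = f.1˘ ⨾ (a ⨾ g.1 ⨾ g.1˘) := by rw [comp_assoc a]
    _ = f.1˘ ⨾ f.1 ⨾ a ⨾ g.1˘ := by rw [← h]; simp only [comp_assoc]
    _ = a ⨾ g.1˘ := by rw [conv_comp_permGroup f.2, side_comp hx ha]
  simpa [conv_comp, conv_conv] using (congrArg conv e).symm

/-- The converse of `g ⨾ a˘ = a˘` is `a ⨾ g˘ = a`, so `g` lies in one stabilizer exactly when `g⁻¹`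
lies in the other, and subgroups are closed under inverses. The hypothesis `a' = a˘` is kept as an
equation so that the symmetry law of a scaffold can be fed in directly. -/
theorem leftStab_conv (ha : a ≤ rect x y) {a' : A} (ha' : a' ≤ rect y x) (h : a' = a˘) :
    leftStab ha' = rightStab ha := by
  subst h
  ext g
  have h1 : ∀ k : permGroup y, k ∈ leftStab ha' ↔ k⁻¹ ∈ rightStab ha := fun k => by
    rw [mem_leftStab, mem_rightStab, permGroup.coe_inv]
    constructor <;> intro e
    · simpa [conv_comp, conv_conv] using congrArg conv e
    · simpa [conv_comp, conv_conv] using congrArg conv e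
  rw [h1, inv_mem_iff]

/-- An element `g` with `a ⨾ g ⨾ b` meeting `a ⨾ b` is a product of stabilizing elements. -/
theorem mem_rightStab_sup_leftStab (ha : a ≤ rect x y) (hb : b ≤ rect y z) (ha' : IsAtom a)
    (hb' : IsAtom b) (g : permGroup y) (h : ¬ Disjoint (a ⨾ g.1 ⨾ b) (a ⨾ b)) :
    g ∈ rightStab ha ⊔ leftStab hb := by
  have hx := x.2.le_ident
  have hy := y.2.le_ident
  have hz := z.2.le_ident
  -- The cycle laws move the outer factors `a` and `b` to the other side, leaving two elements below
  -- the square on `y` that meet.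
  have h1 : ¬ Disjoint (b ⨾ b˘) (a˘ ⨾ (a ⨾ g.1)) := fun hd => by
    rw [← cycle_left, comp_assoc] at hd
    exact h (cycle_right.mpr hd.symm)
  -- Measurability of `y` gives a group element `k` meeting both. Then `k ⨾ b` meets `b` and `a ⨾ k`
  -- meets `a ⨾ g`; all are atoms, so equality holds in both cases, and `g = (g k⁻¹) k` is the
  -- factorization sought.
  obtain ⟨k, hk, hd⟩ := exists_permGroup_not_disjoint
    (inf_le_left.trans (comp_le_rect hb (conv_le_rect hy hz hb)))
    (fun e => h1 (disjoint_iff.mpr e))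
  have hkb : k ⨾ b = b := by
    by_contra hne
    exact hd ((cycle_right.mp
      ((isAtom_comp_left hb hb' ⟨k, hk⟩).disjoint_of_ne hb' hne)).mono_right inf_le_left)
  have hak : a ⨾ k = a ⨾ g.1 := by
    by_contra hne
    exact hd ((cycle_left.mp
      ((isAtom_comp_right ha ha' ⟨k, hk⟩).disjoint_of_ne
        (isAtom_comp_right ha ha' g) hne)).mono_right inf_le_right)
  have h2 : g * (⟨k, hk⟩ : permGroup y)⁻¹ ∈ rightStab ha := by
    rw [mem_rightStab, permGroup.coe_mul, permGroup.coe_inv, comp_assoc, ← hak, ← comp_assoc,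
      permGroup.comp_conv ⟨k, hk⟩, comp_side hx hy ha]
  have h3 := Subgroup.mul_mem_sup h2 (mem_leftStab (ha := hb) (f := ⟨k, hk⟩) |>.mpr hkb)
  rwa [inv_mul_cancel_right] at h3

/-- If `c ≤ a ⨾ b`, then `φ_a` maps `H_a H_c` into `K_a H_b`. -/
theorem mem_sup_of_comp_eq (ha : a ≤ rect x y) (hb : b ≤ rect y z) (hc : c ≤ rect x z)
    (ha' : IsAtom a) (hb' : IsAtom b) (hc' : IsAtom c) (h : c ≤ a ⨾ b)
    {f : permGroup x} {g : permGroup y} (hfg : f.1 ⨾ a = a ⨾ g.1)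
    (hf : f ∈ leftStab ha ⊔ leftStab hc) : g ∈ rightStab ha ⊔ leftStab hb := by
  have hn := leftStab_normal ha ha'
  obtain ⟨p, hp, q, hq, rfl⟩ := Subgroup.mem_sup_of_normal_left.mp hf
  refine mem_rightStab_sup_leftStab ha hb ha' hb' g fun hd => hc'.1 ?_
  have hq' := mem_leftStab.mp hq
  have hp' := mem_leftStab.mp (hn.conj_mem p hp q⁻¹)
  -- Normality of `H_a` lets the factor `p` pass to the right of `q`, where `a` absorbs its
  -- conjugate.
  have e : q.1 ⨾ a = a ⨾ g.1 := by
    rw [← hfg, permGroup.coe_mul]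
    have e1 : p * q = q * (q⁻¹ * p * q⁻¹⁻¹) := by group
    rw [← permGroup.coe_mul, e1, permGroup.coe_mul, ← comp_assoc, hp']
  -- The nonzero element `c` lies below both products, since `q` fixes `c`.
  refine disjoint_self.mp (hd.mono ?_ h)
  calc c = q.1 ⨾ c := hq'.symm
    _ ≤ q.1 ⨾ (a ⨾ b) := comp_mono le_rfl h
    _ = a ⨾ g.1 ⨾ b := by rw [comp_assoc, e]

/-- Every `f` has a partner `g` and every `g` a partner `f`, so images of subgroups under `φ_a` can
be compared on partners alone. -/
theorem atomIso_map_eq (ha : a ≤ rect x y) (ha' : IsAtom a) {M : Subgroup (permGroup x)}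
    {N : Subgroup (permGroup y)}
    (h : ∀ f g, f.1 ⨾ a = a ⨾ g.1 → (f ∈ M ↔ g ∈ N)) :
    haveI := leftStab_normal ha ha'
    haveI := rightStab_normal ha ha'
    (M.map (QuotientGroup.mk' (leftStab ha))).map (atomIso ha ha').toMonoidHom =
      N.map (QuotientGroup.mk' (rightStab ha)) := by
  have := leftStab_normal ha ha'
  have := rightStab_normal ha ha'
  ext q
  constructor
  · rintro ⟨_, ⟨f, hf, rfl⟩, rfl⟩
    obtain ⟨g, hg⟩ := exists_comp_eq ha ha' f
    exact ⟨g, (h f g hg).mp hf, ((atomIso_eq_iff ha ha' f g).mpr hg).symm⟩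
  · rintro ⟨g, hg, rfl⟩
    obtain ⟨f, hf⟩ := exists_comp_eq' ha ha' g
    exact ⟨f, ⟨f, (h f g hf).mpr hg, rfl⟩, (atomIso_eq_iff ha ha' f g).mpr hf⟩

end Measurable

/-! ### The frame conditions for a scaffold -/

namespace Scaffold

variable {A : Type*} [RelationAlgebra A] (S : Scaffold A) {x y z : MeasurableAtom A}

theorem leftStab_symm (h : atomSetoid A x y) (h' : atomSetoid A y x) :
    leftStab (S.le_rect y x h') = rightStab (S.le_rect x y h) :=
  leftStab_conv _ _ (S.symm x y h h')

/-- Both directions are instances of `mem_sup_of_comp_eq`: the triple `(x, y, z)` gives one and `(y,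
x, z)`, with converses taken, gives the other. -/
theorem mem_sup_iff (hxy : atomSetoid A x y) (hyz : atomSetoid A y z) (hxz : atomSetoid A x z)
    (f : permGroup x) (g : permGroup y) (hfg : f.1 ⨾ S.a x y hxy = S.a x y hxy ⨾ g.1) :
    f ∈ leftStab (S.le_rect x y hxy) ⊔ leftStab (S.le_rect x z hxz) ↔
      g ∈ rightStab (S.le_rect x y hxy) ⊔ leftStab (S.le_rect y z hyz) := by
  have hyx := (atomSetoid A).symm hxy
  constructor
  · exact mem_sup_of_comp_eq _ _ _ (S.isAtom _ _ _) (S.isAtom _ _ _) (S.isAtom _ _ _)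
      (S.trans x y z hxy hyz hxz) hfg
  · intro hg
    have e := comp_conv_eq_conv_comp (S.le_rect x y hxy) hfg
    rw [← S.symm x y hxy hyx] at e
    rw [← S.leftStab_symm hxy hyx] at hg
    have := mem_sup_of_comp_eq (S.le_rect y x hyx) (S.le_rect x z hxz) (S.le_rect y z hyz)
      (S.isAtom _ _ _) (S.isAtom _ _ _) (S.isAtom _ _ _) (S.trans y x z hyx hxz hyz) e hg
    rwa [← S.leftStab_symm hyx hxy] at this

theorem groupPair_φ_mk_iff (h : S.groupPair.E x y) (f : permGroup x) (g : permGroup y) :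
    S.groupPair.φ x y h (f : permGroup x ⧸ leftStab (S.le_rect x y h)) =
      (g : permGroup y ⧸ rightStab (S.le_rect x y h)) ↔
      f.1 ⨾ S.a x y h = S.a x y h ⨾ g.1 :=
  atomIso_eq_iff (S.le_rect x y h) (S.isAtom x y h) f g

theorem induces_left (hxy : S.groupPair.E x y) (hyz : S.groupPair.E y z) (hxz : S.groupPair.E x z) :
    Induces (S.groupPair.φ x y hxy) (S.groupPair.H x y hxy ⊔ S.groupPair.H x z hxz)
      (S.groupPair.K x y hxy ⊔ S.groupPair.H y z hyz) :=
  ⟨le_sup_left, le_sup_left, atomIso_map_eq _ _ (S.mem_sup_iff hxy hyz hxz)⟩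

/-- This is `induces_left` for the cyclically permuted triple `(y, z, x)`, with `H_yx = K_xy` and
`H_zx = K_xz`. -/
theorem induces_middle (hxy : S.groupPair.E x y) (hyz : S.groupPair.E y z)
    (hxz : S.groupPair.E x z) :
    Induces (S.groupPair.φ y z hyz) (S.groupPair.K x y hxy ⊔ S.groupPair.H y z hyz)
      (S.groupPair.K x z hxz ⊔ S.groupPair.K y z hyz) := by
  have hyx := S.groupPair.E.symm hxy
  have hzx := S.groupPair.E.symm hxz
  have i := S.induces_left hyz hzx hyx
  have e1 : S.groupPair.H y x hyx = S.groupPair.K x y hxy := S.leftStab_symm hxy hyx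
  have e2 : S.groupPair.H z x hzx = S.groupPair.K x z hxz := S.leftStab_symm hxz hzx
  rwa [e1, e2, sup_comm, sup_comm (S.groupPair.K y z hyz)] at i

/-- This is `induces_left` for `(x, z, y)`, with `H_zy = K_yz`. -/
theorem induces_right (hxy : S.groupPair.E x y) (hyz : S.groupPair.E y z)
    (hxz : S.groupPair.E x z) :
    Induces (S.groupPair.φ x z hxz) (S.groupPair.H x y hxy ⊔ S.groupPair.H x z hxz)
      (S.groupPair.K x z hxz ⊔ S.groupPair.K y z hyz) := by
  have hzy := S.groupPair.E.symm hyz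
  have i := S.induces_left hxz hzy hxy
  have e : S.groupPair.H z y hzy = S.groupPair.K y z hyz := S.leftStab_symm hyz hzy
  rwa [e, sup_comm (S.groupPair.H x z hxz)] at i

/-- If `f` is carried to `g`, `g` to `h` and `f` to `h'`, then `h` and `h'` agree modulo
`K_xz K_yz`. -/
theorem mul_inv_mem_sup (hxy : atomSetoid A x y) (hyz : atomSetoid A y z)
    (hxz : atomSetoid A x z) {f : permGroup x} {g : permGroup y} {h h' : permGroup z}
    (e1 : f.1 ⨾ S.a x y hxy = S.a x y hxy ⨾ g.1) (e2 : g.1 ⨾ S.a y z hyz = S.a y z hyz ⨾ h.1)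
    (e3 : f.1 ⨾ S.a x z hxz = S.a x z hxz ⨾ h'.1) :
    h' * h⁻¹ ∈ rightStab (S.le_rect x z hxz) ⊔ rightStab (S.le_rect y z hyz) := by
  have hzy := (atomSetoid A).symm hyz
  have hz := z.2.le_ident
  rw [← S.leftStab_symm hyz hzy]
  refine mem_rightStab_sup_leftStab _ _ (S.isAtom _ _ _) (S.isAtom _ _ _) _ fun hd => ?_
  have hle : S.a x z hxz ⨾ (h' * h⁻¹ : permGroup z).1 ≤ S.a x y hxy ⨾ S.a y z hyz := calc
    _ = f.1 ⨾ S.a x z hxz ⨾ h.1˘ := by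
      rw [e3, permGroup.coe_mul, permGroup.coe_inv, comp_assoc]
    _ ≤ f.1 ⨾ (S.a x y hxy ⨾ S.a y z hyz) ⨾ h.1˘ :=
      comp_mono (comp_mono le_rfl (S.trans x y z hxy hyz hxz)) le_rfl
    _ = S.a x y hxy ⨾ (g.1 ⨾ S.a y z hyz) ⨾ h.1˘ := by rw [comp_assoc, e1, ← comp_assoc _ g.1]
    _ = S.a x y hxy ⨾ S.a y z hyz ⨾ (h.1 ⨾ h.1˘) := by rw [e2]; simp only [comp_assoc]
    _ = _ := by
      rw [permGroup.comp_conv, ← comp_assoc,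
        comp_side y.2.le_ident hz (S.le_rect y z hyz)]
  -- If the products were disjoint, `a_xy ≤ a_xz ⨾ a_zy` would be disjoint from the first; the cycle
  -- law then separates `a_xz ⨾ h' ⨾ h˘` from `a_xy ⨾ a_yz`, although it is nonzero and lies below
  -- it.
  have hd' := hd.mono_right (S.trans x z y hxz hzy hxy)
  rw [cycle_right, S.symm y z hyz hzy, conv_conv] at hd'
  exact (isAtom_comp_right (S.le_rect x z hxz) (S.isAtom x z hxz) (h' * h⁻¹)).1
    (disjoint_self.mp (hd'.mono_right hle))

theorem groupPair_isFrame : S.groupPair.IsFrame where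
  refl x h := by
    have e := S.refl x h
    have hH : S.groupPair.H x x h = ⊥ := by
      refine (Subgroup.eq_bot_iff_forall _).mpr fun f hf => Subtype.ext ?_
      have hf' : f.1 ⨾ S.a x x h = S.a x x h := hf
      rw [e] at hf'
      rwa [comp_side x.2.le_ident x.2.le_ident f.2.2.1] at hf'
    have hK : S.groupPair.K x x h = ⊥ := by
      refine (Subgroup.eq_bot_iff_forall _).mpr fun f hf => Subtype.ext ?_
      have hf' : S.a x x h ⨾ f.1 = S.a x x h := hf
      rw [e] at hf'
      rwa [side_comp x.2.le_ident f.2.2.1] at hf'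
    refine ⟨hH, hK, MulEquiv.ext fun q => ?_⟩
    obtain ⟨f, rfl⟩ := QuotientGroup.mk_surjective q
    refine (S.groupPair_φ_mk_iff h f f).mpr ?_
    rw [e, comp_side x.2.le_ident x.2.le_ident f.2.2.1, side_comp x.2.le_ident f.2.2.1]
  symm x y h h' := by
    have hK : S.groupPair.H x y h = S.groupPair.K y x h' := S.leftStab_symm h' h
    refine ⟨S.leftStab_symm h h', hK, MulEquiv.ext fun q => ?_⟩
    obtain ⟨g, rfl⟩ := QuotientGroup.mk_surjective q
    obtain ⟨f, hf⟩ := exists_comp_eq' (S.le_rect x y h) (S.isAtom x y h) g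
    have e1 := (S.groupPair_φ_mk_iff h f g).mpr hf
    have e2 := comp_conv_eq_conv_comp (S.le_rect x y h) hf
    rw [← S.symm x y h h'] at e2
    refine ((S.groupPair_φ_mk_iff h' g f).mpr e2).trans ?_
    have e3 := (MulEquiv.symm_apply_eq _).mpr e1.symm
    exact (congrArg (QuotientGroup.quotientMulEquivOfEq hK) e3).symm
  image x y z hxy hyz hxz := (S.induces_left hxy hyz hxz).map_eq
  comp x y z hxy hyz hxz := by
    refine ⟨S.induces_left hxy hyz hxz, S.induces_middle hxy hyz hxz,
      S.induces_right hxy hyz hxz, MulEquiv.ext fun q => ?_⟩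
    obtain ⟨f, rfl⟩ := QuotientGroup.mk_surjective q
    obtain ⟨g, hg⟩ := exists_comp_eq (S.le_rect x y hxy) (S.isAtom x y hxy) f
    obtain ⟨h, hh⟩ := exists_comp_eq (S.le_rect y z hyz) (S.isAtom y z hyz) g
    obtain ⟨h', hh'⟩ := exists_comp_eq (S.le_rect x z hxz) (S.isAtom x z hxz) f
    rw [MulEquiv.trans_apply,
      inducedIso_mk (S.induces_left hxy hyz hxz) ((S.groupPair_φ_mk_iff hxy f g).mpr hg),
      inducedIso_mk (S.induces_middle hxy hyz hxz) ((S.groupPair_φ_mk_iff hyz g h).mpr hh),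
      inducedIso_mk (S.induces_right hxy hyz hxz) ((S.groupPair_φ_mk_iff hxz f h').mpr hh')]
    have hn : (S.groupPair.K x z hxz ⊔ S.groupPair.K y z hyz).Normal := inferInstance
    -- Equality of left cosets asks for `h⁻¹ * h'`; normality exchanges the factors of `h' * h⁻¹`.
    exact QuotientGroup.eq.mpr (hn.mem_comm (S.mul_inv_mem_sup hxy hyz hxz hg hh hh'))

end Scaffold

end RelationAlgebra

theorem mainTheorem12 {A : Type*} [RelationAlgebra A] (hA : RelationAlgebra.IsMeasurable A)
    (S : RelationAlgebra.Scaffold A) : S.groupPair.IsFrame :=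
  S.groupPair_isFrame
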